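/- Let $n\ge 0$, $[n]=\{1,\dots,n\}$, and let $X(t)=X([n],\mathbf p;t)$, $t\ge 0$, be the dynamic multi-parameter simplicial complex: for every $A\subseteq[n]$ with $|A|=i+1\ge 2$ let $\Delta_A(t)=\sum_{j\ge 0}\mathbf 1\{S_j\le t<S_{j+1}\}I_j$, where $S_0=0$, $S_1=D$, $S_j=D+Z_2+\dots+Z_j$ $(j\ge2)$, the $I_j$ are Bernoulli$(p_i)$ with $p_i\in[0,1]$, the $Z_j$ are positive with distribution function $G_i$ of finite mean $\mu_i$, $\mathbb P(D\le x)=\mu_i^{-1}\int_0^x(1-G_i(y))\,dy$ for $x\ge 0$, and all these random variables (for all $A$) are independent; a nonempty set $A\subseteq[n]$ is a face of $X(t)$ if and only if $\Delta_B(t)=1$ for all $B\subseteq A$ with $|B|\ge2$. A simplicial complex $K$ is *$\ell$-strongly connected* if its $\ell$-skeleton is $\ell$-dimensional and pure (every face is contained in an $\ell$-face) and any two $\ell$-faces of $K$ can be joined by a finite sequence of $\ell$-faces of $K$ in which consecutive faces intersect in dimension $\ell-1$. A *maximal* $\ell$-strongly connected subcomplex of $X$ is one that is contained in no other $\ell$-strongly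 connected subcomplex of $X$. Let $\beta_\ell$ be the $\ell$-th (reduced) Betti number, i.e. the rank of the $\ell$-th simplicial homology with coefficients in a fixed integral domain (e.g. $\mathbb Z$ or a field). For $\sigma\subseteq[n]$ with $|\sigma|=j$ let $\eta_\sigma^{(j,r,\ell)}(t)$ be the number of maximal $\ell$-strongly connected subcomplexes $K$ of $X(t)$ with vertex set $\sigma$ and $\beta_\ell(K)=r$. Then for every $\ell\ge1$, every $t\ge0$ and every realization, $$\beta_\ell(X(t))=\sum_{j=\ell+2}^{n}\ \sum_{r\ge1}\ \sum_{\sigma\subseteq[n],\,|\sigma|=j} r\,\eta_\sigma^{(j,r,\ell)}(t);$$ equivalently, $$\beta_\ell(X(t))=\sum_{K}\beta_\ell(K),$$ where $K$ runs over the maximal $\ell$-strongly connected subcomplexes of $X(t)$. Moreover, if $\ell=1$, or if the restriction $X(\sigma;t)$ of $X(t)$ to $\sigma$ is $\ell$-strongly connected, then $\eta_\sigma^{(j,r,\ell)}(t)$ is the indicator that $X(\sigma;t)$ is a maximal $\ell$-strongly connected subcomplex of $X(t)$ with $\beta_\ell(X(\sigma;t))=r$. -/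

import Mathlib

open MeasureTheory ProbabilityTheory

noncomputable section

namespace DynComplex

/-! ### Simplicial homology and Betti numbers

A simplicial complex on the vertex type `V` is a `PreAbstractSimplicialComplex V`: a family of
nonempty finite subsets of `V`, closed under passing to nonempty subsets. The vertices are the
`v` with `{v}` a face, and a face `s` has dimension `s.card - 1`. -/

section Homology

/-- The quotient `Z / B` (for `B ≤ Z`) of submodules of a module. -/
abbrev Subquotient (R : Type*) {M : Type*} [CommRing R] [AddCommGroup M] [Module R M]
    (Z B : Submodule R M) : Type _ :=
  Z ⧸ B.submoduleOf Z

variable {V : Type*} [LinearOrder V]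

/-- The simplicial boundary operator
`∂ [v₀ < v₁ < ⋯ < v_m] = ∑ᵢ (-1)^i [v₀, …, v̂ᵢ, …, v_m]`,
on the free module generated by all finite subsets of the ordered vertex set. -/
def boundary (R : Type*) [CommRing R] : (Finset V →₀ R) →ₗ[R] (Finset V →₀ R) :=
  Finsupp.lift (Finset V →₀ R) R (Finset V) fun s =>
    ∑ v ∈ s, Finsupp.single (s.erase v) ((-1 : R) ^ (s.filter (· < v)).card)

/-- The chains of `K` on faces with exactly `c` vertices (that is, of dimension `c - 1`), in the
augmented complex: the empty simplex is a generator for `c = 0`. -/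
def chains (R : Type*) [CommRing R] (K : PreAbstractSimplicialComplex V) (c : ℕ) :
    Submodule R (Finset V →₀ R) :=
  Finsupp.supported R R {s | (s ∈ K ∨ s = ∅) ∧ s.card = c}

/-- The (reduced) `ℓ`-cycles of `K`. -/
def cycles (R : Type*) [CommRing R] (K : PreAbstractSimplicialComplex V) (ℓ : ℕ) :
    Submodule R (Finset V →₀ R) :=
  chains R K (ℓ + 1) ⊓ LinearMap.ker (boundary R)

/-- The `ℓ`-boundaries of `K`. -/
def boundaries (R : Type*) [CommRing R] (K : PreAbstractSimplicialComplex V) (ℓ : ℕ) :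
    Submodule R (Finset V →₀ R) :=
  (chains R K (ℓ + 2)).map (boundary R)

/-- The `ℓ`-th (reduced) Betti number of `K` with coefficients in `R`: the rank of the reduced
homology module `H_ℓ(K; R) = Z_ℓ / B_ℓ`. -/
def betti (R : Type*) [CommRing R] (ℓ : ℕ) (K : PreAbstractSimplicialComplex V) : ℕ :=
  Module.finrank R (Subquotient R (cycles R K ℓ) (boundaries R K ℓ))

end Homology

/-! ### Strong connectivity -/

section StrongConnectivity

variable {V : Type*} [DecidableEq V]

/-- `s` is an `ℓ`-dimensional face of `K`. -/
def IsFace (K : PreAbstractSimplicialComplex V) (ℓ : ℕ) (s : Finset V) : Prop :=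
  s ∈ K ∧ s.card = ℓ + 1

/-- The `ℓ`-skeleton: all faces of dimension at most `ℓ`. -/
def skeleton (K : PreAbstractSimplicialComplex V) (ℓ : ℕ) : PreAbstractSimplicialComplex V where
  faces := {s | s ∈ K ∧ s.card ≤ ℓ + 1}
  isRelLowerSet_faces := fun {_} hs =>
    ⟨(K.isRelLowerSet_faces hs.1).1, fun _ hts ht =>
      ⟨(K.isRelLowerSet_faces hs.1).2 hts ht, (Finset.card_le_card hts).trans hs.2⟩⟩

/-- `K` is `ℓ`-dimensional: it has an `ℓ`-face and no face of larger dimension. -/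
def HasDim (K : PreAbstractSimplicialComplex V) (ℓ : ℕ) : Prop :=
  (∃ s, IsFace K ℓ s) ∧ ∀ s ∈ K, s.card ≤ ℓ + 1

/-- `K` is a pure `ℓ`-dimensional complex: it is `ℓ`-dimensional and every face is contained in
an `ℓ`-face. -/
def IsPure (K : PreAbstractSimplicialComplex V) (ℓ : ℕ) : Prop :=
  HasDim K ℓ ∧ ∀ s ∈ K, ∃ u, IsFace K ℓ u ∧ s ⊆ u

/-- Two `ℓ`-faces of `K` whose intersection has dimension `ℓ - 1`. -/
def Adjacent (K : PreAbstractSimplicialComplex V) (ℓ : ℕ) (s u : Finset V) : Prop :=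
  IsFace K ℓ s ∧ IsFace K ℓ u ∧ (s ∩ u).card = ℓ

/-- `K` is strongly connected of order `ℓ`: its `ℓ`-skeleton is pure and any two `ℓ`-faces are
joined by a sequence of successively adjacent `ℓ`-faces. -/
def IsStronglyConnected (ℓ : ℕ) (K : PreAbstractSimplicialComplex V) : Prop :=
  IsPure (skeleton K ℓ) ℓ ∧
    ∀ s u, IsFace K ℓ s → IsFace K ℓ u → Relation.ReflTransGen (Adjacent K ℓ) s u

/-- `K` is a maximal `ℓ`-strongly connected subcomplex of `X`. -/
def IsMaxStronglyConnected (X : PreAbstractSimplicialComplex V) (ℓ : ℕ)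
    (K : PreAbstractSimplicialComplex V) : Prop :=
  Maximal (fun L => L ≤ X ∧ IsStronglyConnected ℓ L) K

/-- The set of vertices of `K`. -/
def vertexSet (K : PreAbstractSimplicialComplex V) : Set V := {v | {v} ∈ K}

/-- The restriction of `X` to the vertex set `σ`. -/
def restrict (X : PreAbstractSimplicialComplex V) (σ : Finset V) :
    PreAbstractSimplicialComplex V where
  faces := {s | s ∈ X ∧ s ⊆ σ}
  isRelLowerSet_faces := fun {_} hs =>
    ⟨(X.isRelLowerSet_faces hs.1).1, fun _ hts ht =>
      ⟨(X.isRelLowerSet_faces hs.1).2 hts ht, subset_trans hts hs.2⟩⟩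

end StrongConnectivity

section Eta

variable {V : Type*} [LinearOrder V]

/-- `η_σ^{(j,r,ℓ)}` for `j = |σ|`: the number of maximal `ℓ`-strongly connected subcomplexes of `X`
with vertex set `σ` and `ℓ`-th Betti number `r`. -/
def eta (R : Type*) [CommRing R] (X : PreAbstractSimplicialComplex V) (r ℓ : ℕ) (σ : Finset V) :
    ℕ :=
  Set.ncard {K : PreAbstractSimplicialComplex V |
    IsMaxStronglyConnected X ℓ K ∧ vertexSet K = (σ : Set V) ∧ betti R ℓ K = r}

open Classical in
/-- The indicator that the restriction of `X` to `σ` is a maximal `ℓ`-strongly connected subcomplex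
of `X` with `ℓ`-th Betti number `r`. -/
def inducedEta (R : Type*) [CommRing R] (X : PreAbstractSimplicialComplex V) (r ℓ : ℕ)
    (σ : Finset V) : ℕ :=
  if IsMaxStronglyConnected X ℓ (restrict X σ) ∧ betti R ℓ (restrict X σ) = r then 1 else 0

end Eta

/-! ### The dynamic multi-parameter simplicial complex -/

/-- The sets `A ⊆ [n]` with at least two elements; `A` carries the on/off process `Δ_{i,A}` with
`i = |A| - 1`. -/
abbrev Simplex (n : ℕ) : Type := {A : Finset (Fin n) // 2 ≤ A.card}

/-- The dimension `i = |A| - 1` of `A`. -/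
def Simplex.dim {n : ℕ} (A : Simplex n) : ℕ := A.1.card - 1

/-- Labels of the random variables that drive one on/off process: the delay `D`, the interarrival
times `Z_{j+2}` (`gap j`) and the coins `I_j`, `j ≥ 0`. -/
inductive Input : Type
  | delay : Input
  | gap (j : ℕ) : Input
  | coin (j : ℕ) : Input

/-- The probabilistic assumptions: for every `A` of dimension `i`, the coins are Bernoulli(`p i`),
the interarrival times are positive with law `G i` of finite mean, the delay has the equilibrium
distribution of `G i`, and all these variables, over all `A`, are independent. -/
structure IsModel {Ω : Type*} [MeasurableSpace Ω] (P : Measure Ω) (n : ℕ) (p : ℕ → ℝ)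
    (G : ℕ → Measure ℝ) (W : Simplex n → Input → Ω → ℝ) : Prop where
  p_mem : ∀ i, 1 ≤ i → i + 1 ≤ n → p i ∈ Set.Icc (0 : ℝ) 1
  prob : ∀ i, 1 ≤ i → i + 1 ≤ n → IsProbabilityMeasure (G i)
  pos : ∀ i, 1 ≤ i → i + 1 ≤ n → G i (Set.Iic 0) = 0
  mean : ∀ i, 1 ≤ i → i + 1 ≤ n → Integrable (fun x : ℝ => x) (G i)
  measurable : ∀ A k, Measurable (W A k)
  coin_zero_or_one : ∀ A j ω, W A (.coin j) ω = 0 ∨ W A (.coin j) ω = 1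
  coin_law : ∀ (A : Simplex n) j, P {ω | W A (.coin j) ω = 1} = ENNReal.ofReal (p A.dim)
  gap_pos : ∀ A j ω, 0 < W A (.gap j) ω
  gap_law : ∀ (A : Simplex n) j, P.map (W A (.gap j)) = G A.dim
  delay_nonneg : ∀ A ω, 0 ≤ W A .delay ω
  delay_law : ∀ (A : Simplex n) (x : ℝ), 0 ≤ x →
    P {ω | W A .delay ω ≤ x} = ENNReal.ofReal
      ((∫ y, y ∂(G A.dim))⁻¹ * ∫ y in (0 : ℝ)..x, (1 - (G A.dim).real (Set.Iic y)))
  indep : iIndepFun (fun (x : Simplex n × Input) => W x.1 x.2) P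

section Dynamics

variable {Ω : Type*} {n : ℕ}

/-- The renewal times: `S_0 = 0`, `S_1 = D` and `S_{j+2} = D + Z_2 + ⋯ + Z_{j+2}`. -/
def renewalTime (W : Simplex n → Input → Ω → ℝ) (A : Simplex n) : ℕ → Ω → ℝ
  | 0, _ => 0
  | j + 1, ω => W A .delay ω + ∑ m ∈ Finset.range j, W A (.gap m) ω

open Classical in
/-- The on/off process `Δ_A(t) = ∑_j 1{S_j ≤ t < S_{j+1}} I_j`. -/
def onOff (W : Simplex n → Input → Ω → ℝ) (A : Simplex n) (t : ℝ) (ω : Ω) : ℝ :=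
  ∑' j : ℕ, if renewalTime W A j ω ≤ t ∧ t < renewalTime W A (j + 1) ω
    then W A (.coin j) ω else 0

/-- The complex `X([n], p; t)`: a nonempty `A ⊆ [n]` is a face at time `t` if and only if all the
processes `Δ_B`, `B ⊆ A`, `|B| ≥ 2`, are on at time `t`. In particular every vertex is present. -/
def dynComplex (W : Simplex n → Input → Ω → ℝ) (t : ℝ) (ω : Ω) :
    PreAbstractSimplicialComplex (Fin n) where
  faces := {A | A.Nonempty ∧ ∀ B : Simplex n, B.1 ⊆ A → onOff W B t ω = 1}
  isRelLowerSet_faces := fun {_} hA =>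
    ⟨hA.1, fun _ hCA hC => ⟨hC, fun B hB => hA.2 B (subset_trans hB hCA)⟩⟩

end Dynamics

end DynComplex

end

/-! The identity holds realization by realization, for any finite complex. A face of dimension `ℓ`
or `ℓ + 1` spans an `ℓ`-strongly connected simplex, so it lies in some maximal subcomplex `K`
(`chains_eq_iSup`). If `ℓ`-faces of two maximal subcomplexes share `ℓ` vertices, their union is
still `ℓ`-strongly connected, so the two coincide (`IsMaxStronglyConnected.eq_of_le_card_inter`).
Hence distinct `K` have disjoint sets of `ℓ`-faces, and disjoint sets of facets of `ℓ`-faces. The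
first makes the `ℓ`-chains, and with them the `ℓ`-boundaries, a direct sum over `K`. The second
keeps the images under `∂` independent, so cycles split too (`iSup_inf_ker_boundary`). Rank is
additive over a domain, which gives `betti_eq_sum`. Grouping the `K` by vertex set and Betti number
gives the formula with `η`. -/

namespace DynComplex

/-! ### Ranks and independent families of submodules -/

section LinearAlgebra

variable {R M N ι : Type*} [CommRing R] [AddCommGroup M] [Module R M] [AddCommGroup N] [Module R N]

/-- The rank is additive along finite independent families of submodules. -/
theorem finrank_iSup_of_iSupIndep [IsDomain R] [Module.Finite R M] [Fintype ι]
    {A : ι → Submodule R M} (hA : iSupIndep A) :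
    Module.finrank R ↥(⨆ i, A i) = ∑ i, Module.finrank R (A i) := by
  classical
  have key : ∀ s : Finset ι, Module.finrank R ↥(s.sup A) = ∑ i ∈ s, Module.finrank R (A i) := by
    intro s
    induction s using Finset.induction_on with
    | empty => rw [Finset.sup_empty, Finset.sum_empty, finrank_bot]
    | insert a s ha ih =>
      have hd : Disjoint (A a) (s.sup A) := by
        rw [Finset.sup_eq_iSup]
        refine (hA a).mono_right (iSup₂_le fun i hi => ?_)
        exact le_iSup₂_of_le i (fun h => ha (h ▸ hi)) le_rfl
      have h := Submodule.rank_sup_add_rank_inf_eq (A a) (s.sup A)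
      rw [hd.eq_bot, ← Submodule.finrank_eq_rank, ← Submodule.finrank_eq_rank,
        ← Submodule.finrank_eq_rank, ← Submodule.finrank_eq_rank] at h
      rw [Finset.sup_insert, Finset.sum_insert ha, ← ih]
      have h' := by exact_mod_cast h
      simpa using h'
  rw [← key, Finset.sup_univ_eq_iSup]

/-- If a linear map sends the members of a family into independent submodules, then its kernel
decomposes along the family. -/
theorem iSup_inf_ker_of_iSupIndep {A : ι → Submodule R M} {D : ι → Submodule R N}
    (f : M →ₗ[R] N) (hf : ∀ i, (A i).map f ≤ D i) (hD : iSupIndep D) :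
    (⨆ i, A i) ⊓ LinearMap.ker f = ⨆ i, A i ⊓ LinearMap.ker f := by
  classical
  refine le_antisymm ?_ (iSup_le fun i => inf_le_inf_right _ (le_iSup A i))
  rintro x ⟨hx, hxf⟩
  obtain ⟨a, rfl⟩ := (Submodule.mem_iSup_iff_exists_dfinsupp' _ _).1 hx
  -- The images `f (a i)` lie in independent submodules and sum to zero, so each vanishes.
  have h0 : ∀ i, f (a i) = 0 := by
    have h : ∑ i ∈ a.support, f (a i) = 0 := by
      have hx' : f (a.sum fun _ x => (x : M)) = 0 := hxf
      rwa [DFinsupp.sum, map_sum] at hx'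
    intro i
    by_cases hi : i ∈ a.support
    · exact (iSupIndep_iff_finsetSum_eq_zero_imp_eq_zero D).1 hD a.support (fun j => f (a j))
        (fun j _ => hf j ⟨a j, (a j).2, rfl⟩) h i hi
    · simp [DFinsupp.notMem_support_iff.1 hi]
  refine Submodule.sum_mem _ fun i _ => Submodule.mem_iSup_of_mem i ⟨(a i).2, h0 i⟩

theorem iSupIndep_supported {α : Type*} {S : ι → Set α}
    (hS : Pairwise fun i j => Disjoint (S i) (S j)) :
    iSupIndep fun i => Finsupp.supported R R (S i) := by
  intro i
  have hle : (⨆ j, ⨆ (_ : j ≠ i), Finsupp.supported R R (S j)) ≤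
      Finsupp.supported R R (⋃ j, ⋃ (_ : j ≠ i), S j) :=
    iSup₂_le fun j hj => Finsupp.supported_mono (Set.subset_iUnion₂_of_subset j hj subset_rfl)
  refine (Finsupp.disjoint_supported_supported ?_).mono_right hle
  simp only [Set.disjoint_iUnion_right]
  exact fun j hj => hS hj.symm

/-- The rank of a subquotient `Z / (Z ∩ B)`. -/
theorem finrank_subquotient_add [IsDomain R] [Module.Finite R M] (Z B : Submodule R M) :
    Module.finrank R (Subquotient R Z B) + Module.finrank R ↥(B ⊓ Z) = Module.finrank R Z := by
  have h := Submodule.rank_quotient_add_rank (B.submoduleOf Z)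
  have e : Module.rank R (B.submoduleOf Z) = Module.rank R ↥(B ⊓ Z) := by
    rw [(Z.equivSubtypeMap (B.submoduleOf Z)).rank_eq, Submodule.submoduleOf,
      Submodule.map_comap_subtype, inf_comm]
  rw [e, ← Submodule.finrank_eq_rank, ← Submodule.finrank_eq_rank R M Z] at h
  -- `finrank` sends infinite ranks to `0`, so finiteness is needed before passing to `ℕ`; the bound
  -- is the rank of `Z`.
  have hlt : Module.rank R (Subquotient R Z B) < Cardinal.aleph0 := by
    refine lt_of_le_of_lt ?_ (Cardinal.natCast_lt_aleph0 (n := Module.finrank R Z))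
    rw [← h]
    exact self_le_add_right _ _
  rw [← Cardinal.cast_toNat_of_lt_aleph0 hlt] at h
  exact_mod_cast h

end LinearAlgebra

/-! ### Maximal strongly connected subcomplexes -/

section Complexes

variable {V : Type*}

instance [Finite V] : Finite (PreAbstractSimplicialComplex V) :=
  Finite.of_injective _ (SetLike.coe_injective (A := PreAbstractSimplicialComplex V))

theorem nonempty_of_mem {K : PreAbstractSimplicialComplex V} {s : Finset V} (hs : s ∈ K) :
    s.Nonempty :=
  (K.isRelLowerSet_faces hs).1

theorem mem_of_subset {K : PreAbstractSimplicialComplex V} {s u : Finset V} (hu : u ∈ K)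
    (hsu : s ⊆ u) (hs : s.Nonempty) : s ∈ K :=
  (K.isRelLowerSet_faces hu).2 hsu hs

/-- The full simplex on the vertex set `s`. -/
def fullSimplex (s : Finset V) : PreAbstractSimplicialComplex V where
  faces := {u | u.Nonempty ∧ u ⊆ s}
  isRelLowerSet_faces := fun {_} hu => ⟨hu.1, fun _ hts ht => ⟨ht, subset_trans hts hu.2⟩⟩

theorem fullSimplex_le {K : PreAbstractSimplicialComplex V} {s : Finset V} (hs : s ∈ K) :
    fullSimplex s ≤ K :=
  fun _ hu => mem_of_subset hs hu.2 hu.1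

variable {ℓ : ℕ} {K L X : PreAbstractSimplicialComplex V}

theorem le_restrict_of_vertexSet_eq (hKX : K ≤ X) {σ : Finset V}
    (hσ : vertexSet K = (σ : Set V)) : K ≤ restrict X σ := by
  refine fun s hs => ⟨hKX hs, fun v hv => ?_⟩
  have : v ∈ vertexSet K :=
    mem_of_subset hs (Finset.singleton_subset_iff.2 hv) (Finset.singleton_nonempty v)
  rw [hσ] at this
  exact this

variable [DecidableEq V]

theorem Adjacent.mono (hKL : K ≤ L) {s u : Finset V} (h : Adjacent K ℓ s u) : Adjacent L ℓ s u :=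
  ⟨⟨hKL h.1.1, h.1.2⟩, ⟨hKL h.2.1.1, h.2.1.2⟩, h.2.2⟩

theorem reflTransGen_mono (hKL : K ≤ L) {s u : Finset V}
    (h : Relation.ReflTransGen (Adjacent K ℓ) s u) : Relation.ReflTransGen (Adjacent L ℓ) s u :=
  Relation.ReflTransGen.mono (fun _ _ => Adjacent.mono hKL) _ _ h

theorem reflTransGen_symm {s u : Finset V} (h : Relation.ReflTransGen (Adjacent K ℓ) s u) :
    Relation.ReflTransGen (Adjacent K ℓ) u s :=
  have : Std.Symm (Adjacent K ℓ) :=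
    ⟨fun _ _ h => ⟨h.2.1, h.1, by rw [Finset.inter_comm]; exact h.2.2⟩⟩
  Relation.ReflTransGen.stdSymm.symm _ _ h

/-- Two `ℓ`-faces that share at least `ℓ` vertices are joined by a path of length at most one. -/
theorem reflTransGen_of_le_card_inter {s u : Finset V} (hs : IsFace K ℓ s) (hu : IsFace K ℓ u)
    (h : ℓ ≤ (s ∩ u).card) : Relation.ReflTransGen (Adjacent K ℓ) s u := by
  rcases h.eq_or_lt with h | h
  · exact .single ⟨hs, hu, h.symm⟩
  · have h1 : s ∩ u = s :=
      Finset.eq_of_subset_of_card_le Finset.inter_subset_left (by rw [hs.2]; exact h)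
    have h2 : s ∩ u = u :=
      Finset.eq_of_subset_of_card_le Finset.inter_subset_right (by rw [hu.2]; exact h)
    rw [← h1, h2]

/-- `K` and its `ℓ`-skeleton have the same `ℓ`-faces, so the skeleton can be eliminated. -/
theorem isStronglyConnected_iff : IsStronglyConnected ℓ K ↔
    (∃ s, IsFace K ℓ s) ∧ (∀ s ∈ K, s.card ≤ ℓ + 1 → ∃ u, IsFace K ℓ u ∧ s ⊆ u) ∧
      ∀ s u, IsFace K ℓ s → IsFace K ℓ u → Relation.ReflTransGen (Adjacent K ℓ) s u := by
  have hface : ∀ s, IsFace (skeleton K ℓ) ℓ s ↔ IsFace K ℓ s :=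
    fun s => ⟨fun h => ⟨h.1.1, h.2⟩, fun h => ⟨⟨h.1, h.2.le⟩, h.2⟩⟩
  simp only [IsStronglyConnected, IsPure, HasDim, hface]
  exact ⟨fun ⟨⟨⟨h1, _⟩, h2⟩, h3⟩ => ⟨h1, fun s hs hc => h2 s ⟨hs, hc⟩, h3⟩,
    fun ⟨h1, h2, h3⟩ => ⟨⟨⟨h1, fun s hs => hs.2⟩, fun s hs => h2 s hs.1 hs.2⟩, h3⟩⟩

/-- A simplex with `ℓ + 1` or `ℓ + 2` vertices is `ℓ`-strongly connected. -/
theorem isStronglyConnected_fullSimplex {s : Finset V} (h1 : ℓ + 1 ≤ s.card)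
    (h2 : s.card ≤ ℓ + 2) : IsStronglyConnected ℓ (fullSimplex s) := by
  have hface : ∀ u ⊆ s, u.card = ℓ + 1 → IsFace (fullSimplex s) ℓ u := fun u hus hc =>
    ⟨⟨Finset.card_pos.1 (by omega), hus⟩, hc⟩
  refine isStronglyConnected_iff.2 ⟨?_, ?_, ?_⟩
  · obtain ⟨u, hus, hu⟩ := Finset.exists_subset_card_eq h1
    exact ⟨u, hface u hus hu⟩
  · intro u hu hc
    obtain ⟨w, huw, hws, hw⟩ := Finset.exists_subsuperset_card_eq hu.2 hc h1
    exact ⟨w, hface w hws hw, huw⟩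
  · intro u w hu hw
    refine reflTransGen_of_le_card_inter hu hw ?_
    -- `|u ∩ w| = 2(ℓ + 1) - |u ∪ w| ≥ 2(ℓ + 1) - (ℓ + 2) = ℓ`.
    have h3 := Finset.card_union_add_card_inter u w
    have h4 := Finset.card_le_card (Finset.union_subset hu.1.2 hw.1.2)
    have h5 := hu.2
    have h6 := hw.2
    omega

/-- The union of two `ℓ`-strongly connected complexes having `ℓ`-faces that share at least `ℓ`
vertices is `ℓ`-strongly connected. -/
theorem IsStronglyConnected.sup (hK : IsStronglyConnected ℓ K) (hL : IsStronglyConnected ℓ L)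
    {a b : Finset V} (ha : IsFace K ℓ a) (hb : IsFace L ℓ b) (hab : ℓ ≤ (a ∩ b).card) :
    IsStronglyConnected ℓ (K ⊔ L) := by
  have hKs : K ≤ K ⊔ L := le_sup_left
  have hLs : L ≤ K ⊔ L := le_sup_right
  obtain ⟨-, hK2, hK3⟩ := isStronglyConnected_iff.1 hK
  obtain ⟨-, hL2, hL3⟩ := isStronglyConnected_iff.1 hL
  have hbridge : Relation.ReflTransGen (Adjacent (K ⊔ L) ℓ) a b :=
    reflTransGen_of_le_card_inter ⟨hKs ha.1, ha.2⟩ ⟨hLs hb.1, hb.2⟩ hab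
  have hto : ∀ s, IsFace (K ⊔ L) ℓ s → Relation.ReflTransGen (Adjacent (K ⊔ L) ℓ) s b := by
    rintro s ⟨hs | hs, hc⟩
    · exact (reflTransGen_mono hKs (hK3 s a ⟨hs, hc⟩ ha)).trans hbridge
    · exact reflTransGen_mono hLs (hL3 s b ⟨hs, hc⟩ hb)
  refine isStronglyConnected_iff.2 ⟨⟨a, hKs ha.1, ha.2⟩, ?_, fun s u hs hu =>
    (hto s hs).trans (reflTransGen_symm (hto u hu))⟩
  rintro s (hs | hs) hc
  · obtain ⟨u, hu, hsu⟩ := hK2 s hs hc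
    exact ⟨u, ⟨hKs hu.1, hu.2⟩, hsu⟩
  · obtain ⟨u, hu, hsu⟩ := hL2 s hs hc
    exact ⟨u, ⟨hLs hu.1, hu.2⟩, hsu⟩

/-- Distinct maximal `ℓ`-strongly connected subcomplexes have no `ℓ`-faces that share `ℓ`
vertices. -/
theorem IsMaxStronglyConnected.eq_of_le_card_inter (hK : IsMaxStronglyConnected X ℓ K)
    (hL : IsMaxStronglyConnected X ℓ L) {a b : Finset V} (ha : IsFace K ℓ a) (hb : IsFace L ℓ b)
    (hab : ℓ ≤ (a ∩ b).card) : K = L := by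
  have hsc : K ⊔ L ≤ X ∧ IsStronglyConnected ℓ (K ⊔ L) :=
    ⟨sup_le hK.prop.1 hL.prop.1, hK.prop.2.sup hL.prop.2 ha hb hab⟩
  rw [hK.eq_of_le hsc le_sup_left]
  exact (hL.eq_of_le hsc le_sup_right).symm

/-- Every `ℓ`-strongly connected subcomplex is contained in a maximal one. -/
theorem exists_le_isMaxStronglyConnected [Finite V] (hLX : L ≤ X)
    (hL : IsStronglyConnected ℓ L) : ∃ K, L ≤ K ∧ IsMaxStronglyConnected X ℓ K :=
  (Set.toFinite {L | L ≤ X ∧ IsStronglyConnected ℓ L}).exists_le_maximal ⟨hLX, hL⟩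

theorem exists_mem_isMaxStronglyConnected [Finite V] {s : Finset V} (hs : s ∈ X)
    (h1 : ℓ + 1 ≤ s.card) (h2 : s.card ≤ ℓ + 2) :
    ∃ K, IsMaxStronglyConnected X ℓ K ∧ s ∈ K := by
  obtain ⟨K, hle, hK⟩ := exists_le_isMaxStronglyConnected (fullSimplex_le hs)
    (isStronglyConnected_fullSimplex h1 h2)
  exact ⟨K, hK, hle ⟨nonempty_of_mem hs, subset_rfl⟩⟩

/-- If `σ` is the vertex set of a `1`-strongly connected subcomplex of `X`, then the restriction of
`X` to `σ` is `1`-strongly connected. -/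
theorem isStronglyConnected_one_restrict (hKX : K ≤ X) (hK : IsStronglyConnected 1 K)
    {σ : Finset V} (hσ : vertexSet K = (σ : Set V)) :
    IsStronglyConnected 1 (restrict X σ) := by
  have hle := le_restrict_of_vertexSet_eq hKX hσ
  obtain ⟨⟨e, he⟩, h2, h3⟩ := isStronglyConnected_iff.1 hK
  have hedge : ∀ v ∈ σ, ∃ u, IsFace K 1 u ∧ v ∈ u := by
    intro v hv
    have hvK : v ∈ vertexSet K := by rw [hσ]; exact hv
    obtain ⟨u, hu, hvu⟩ := h2 {v} hvK (by simp)
    exact ⟨u, hu, Finset.singleton_subset_iff.1 hvu⟩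
  have hto : ∀ s, IsFace (restrict X σ) 1 s →
      Relation.ReflTransGen (Adjacent (restrict X σ) 1) s e := by
    intro s hs
    obtain ⟨v, hv⟩ := nonempty_of_mem hs.1
    obtain ⟨u, hu, hvu⟩ := hedge v (hs.1.2 hv)
    -- This is where `ℓ = 1` matters: one common vertex makes an edge of `X` on `σ` equal or
    -- adjacent to an edge of `K`.
    refine (reflTransGen_of_le_card_inter hs ⟨hle hu.1, hu.2⟩ ?_).trans
      (reflTransGen_mono hle (h3 u e hu he))
    exact Finset.card_pos.2 ⟨v, Finset.mem_inter.2 ⟨hv, hvu⟩⟩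
  refine isStronglyConnected_iff.2 ⟨⟨e, hle he.1, he.2⟩, fun s hs hc => ?_, fun s u hs hu =>
    (hto s hs).trans (reflTransGen_symm (hto u hu))⟩
  rcases hc.eq_or_lt with hc | hc
  · exact ⟨s, ⟨hs, hc⟩, subset_rfl⟩
  · have h1 : s.card = 1 := by
      have := Finset.card_pos.2 (nonempty_of_mem hs)
      omega
    obtain ⟨v, rfl⟩ := Finset.card_eq_one.1 h1
    obtain ⟨u, hu, hvu⟩ := hedge v (Finset.singleton_subset_iff.1 hs.2)
    exact ⟨u, ⟨hle hu.1, hu.2⟩, Finset.singleton_subset_iff.2 hvu⟩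

/-- `K` always sits inside the restriction to its vertex set; once the latter is strongly connected,
maximality forces equality. -/
theorem IsMaxStronglyConnected.eq_restrict (hK : IsMaxStronglyConnected X ℓ K) {σ : Finset V}
    (hσ : vertexSet K = (σ : Set V)) (h : ℓ = 1 ∨ IsStronglyConnected ℓ (restrict X σ)) :
    K = restrict X σ := by
  have hsc : IsStronglyConnected ℓ (restrict X σ) := by
    rcases h with rfl | h
    · exact isStronglyConnected_one_restrict hK.prop.1 hK.prop.2 hσ
    · exact h
  exact hK.eq_of_le ⟨fun s hs => hs.1, hsc⟩ (le_restrict_of_vertexSet_eq hK.prop.1 hσ)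

end Complexes

/-! ### Decomposition of homology and counting -/

section Betti

variable {V : Type*} [LinearOrder V] (R : Type*) [CommRing R] {ℓ : ℕ}
  {K X : PreAbstractSimplicialComplex V}

theorem boundary_single (s : Finset V) (c : R) :
    boundary R (Finsupp.single s c) =
      ∑ v ∈ s, Finsupp.single (s.erase v) (c * (-1 : R) ^ (s.filter (· < v)).card) := by
  simp [boundary, Finset.smul_sum]

/-- The boundary of a chain supported on `S` is supported on the facets of members of `S`. -/
theorem map_boundary_supported_le {S T : Set (Finset V)}
    (h : ∀ s ∈ S, ∀ v ∈ s, s.erase v ∈ T) :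
    (Finsupp.supported R R S).map (boundary R) ≤ Finsupp.supported R R T := by
  rw [Finsupp.supported_eq_span_single, Submodule.map_span_le]
  rintro _ ⟨s, hs, rfl⟩
  rw [boundary_single]
  exact Submodule.sum_mem _ fun v hv => Finsupp.single_mem_supported R _ (h s hs v hv)

theorem boundaries_le_chains : boundaries R K ℓ ≤ chains R K (ℓ + 1) := by
  refine map_boundary_supported_le R ?_
  rintro s ⟨hs, hc⟩ v hv
  have hcard : (s.erase v).card = ℓ + 1 := by rw [Finset.card_erase_of_mem hv, hc]; rfl
  refine ⟨Or.inl ?_, hcard⟩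
  have hsK : s ∈ K := hs.resolve_right (Finset.ne_empty_of_mem hv)
  exact mem_of_subset hsK (Finset.erase_subset v s) (Finset.card_pos.1 (by omega))

/-- Intersecting the boundaries with `ker ∂` avoids any appeal to `∂ ∘ ∂ = 0`, and both kernels then
split by the same lemma. -/
theorem betti_add_finrank [IsDomain R] [Finite V] :
    betti R ℓ K + Module.finrank R ↥(boundaries R K ℓ ⊓ LinearMap.ker (boundary R)) =
      Module.finrank R ↥(chains R K (ℓ + 1) ⊓ LinearMap.ker (boundary R)) := by
  have h := finrank_subquotient_add (cycles R K ℓ) (boundaries R K ℓ)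
  have he : boundaries R K ℓ ⊓ cycles R K ℓ = boundaries R K ℓ ⊓ LinearMap.ker (boundary R) := by
    rw [cycles, ← inf_assoc, inf_eq_left.2 (boundaries_le_chains R)]
  rwa [he] at h

/-- The `ℓ`-chains and `(ℓ + 1)`-chains decompose along the maximal `ℓ`-strongly connected
subcomplexes. -/
theorem chains_eq_iSup [Finite V] {c : ℕ} (h1 : ℓ + 1 ≤ c) (h2 : c ≤ ℓ + 2) :
    chains R X c = ⨆ K : {K // IsMaxStronglyConnected X ℓ K}, chains R K.1 c := by
  simp only [chains]
  rw [← Finsupp.supported_iUnion]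
  congr 1
  ext s
  simp only [Set.mem_ofPred_eq, Set.mem_iUnion]
  constructor
  · rintro ⟨hs, rfl⟩
    have hs' : s ∈ X := hs.resolve_right (Finset.card_pos.1 (by omega)).ne_empty
    obtain ⟨K, hK, hsK⟩ := exists_mem_isMaxStronglyConnected hs' h1 h2
    exact ⟨⟨K, hK⟩, Or.inl hsK, rfl⟩
  · rintro ⟨K, hs, hc⟩
    exact ⟨hs.imp_left fun h => K.2.prop.1 h, hc⟩

theorem iSupIndep_chains :
    iSupIndep fun K : {K // IsMaxStronglyConnected X ℓ K} => chains R K.1 (ℓ + 1) := by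
  refine iSupIndep_supported fun K L hKL => Set.disjoint_left.2 ?_
  rintro s ⟨hs, hc⟩ ⟨hs', -⟩
  have hne : s ≠ ∅ := (Finset.card_pos.1 (by omega)).ne_empty
  refine hKL (Subtype.ext (K.2.eq_of_le_card_inter L.2 ⟨hs.resolve_right hne, hc⟩
    ⟨hs'.resolve_right hne, hc⟩ ?_))
  rw [Finset.inter_self]
  omega

/-- Cycles decompose along the maximal `ℓ`-strongly connected subcomplexes. -/
theorem iSup_inf_ker_boundary
    {A : {K // IsMaxStronglyConnected X ℓ K} → Submodule R (Finset V →₀ R)}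
    (hA : ∀ K, A K ≤ chains R K.1 (ℓ + 1)) :
    (⨆ K, A K) ⊓ LinearMap.ker (boundary R) = ⨆ K, A K ⊓ LinearMap.ker (boundary R) := by
  -- `D K` is carried by the facets of `ℓ`-faces of `K`. A facet common to `K` and `L` puts `ℓ`
  -- vertices in the intersection of two `ℓ`-faces, so `K = L`.
  refine iSup_inf_ker_of_iSupIndep (D := fun K => Finsupp.supported R R
    {s | s.card = ℓ ∧ ∃ u, IsFace K.1 ℓ u ∧ s ⊆ u}) _ (fun K => ?_) ?_
  · refine (Submodule.map_mono (hA K)).trans (map_boundary_supported_le R ?_)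
    rintro s ⟨hs, hc⟩ v hv
    exact ⟨by rw [Finset.card_erase_of_mem hv, hc]; rfl, s,
      ⟨hs.resolve_right (Finset.ne_empty_of_mem hv), hc⟩, Finset.erase_subset v s⟩
  · refine iSupIndep_supported fun K L hKL => Set.disjoint_left.2 ?_
    rintro s ⟨hc, u, hu, hsu⟩ ⟨-, w, hw, hsw⟩
    refine hKL (Subtype.ext (K.2.eq_of_le_card_inter L.2 hu hw ?_))
    rw [← hc]
    exact Finset.card_le_card (Finset.subset_inter hsu hsw)

/-- The `ℓ`-th Betti number is the sum of the `ℓ`-th Betti numbers of the maximal `ℓ`-strongly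
connected subcomplexes. -/
theorem betti_eq_sum [IsDomain R] [Finite V] [Fintype {K // IsMaxStronglyConnected X ℓ K}] :
    betti R ℓ X = ∑ K : {K // IsMaxStronglyConnected X ℓ K}, betti R ℓ K.1 := by
  have hZ : Module.finrank R ↥(chains R X (ℓ + 1) ⊓ LinearMap.ker (boundary R)) =
      ∑ K : {K // IsMaxStronglyConnected X ℓ K},
        Module.finrank R ↥(chains R K.1 (ℓ + 1) ⊓ LinearMap.ker (boundary R)) := by
    rw [chains_eq_iSup R le_rfl (Nat.le_succ _), iSup_inf_ker_boundary R fun K => le_rfl]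
    exact finrank_iSup_of_iSupIndep ((iSupIndep_chains R).mono fun K => inf_le_left)
  have hB : Module.finrank R ↥(boundaries R X ℓ ⊓ LinearMap.ker (boundary R)) =
      ∑ K : {K // IsMaxStronglyConnected X ℓ K},
        Module.finrank R ↥(boundaries R K.1 ℓ ⊓ LinearMap.ker (boundary R)) := by
    have h : boundaries R X ℓ =
        ⨆ K : {K // IsMaxStronglyConnected X ℓ K}, boundaries R K.1 ℓ := by
      simp only [boundaries]
      rw [chains_eq_iSup R (ℓ := ℓ) (Nat.le_succ _) le_rfl, Submodule.map_iSup]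
    rw [h, iSup_inf_ker_boundary R fun K => boundaries_le_chains R]
    -- Boundaries inherit independence from the `ℓ`-chains; independence of `(ℓ + 1)`-chains is not
    -- required.
    exact finrank_iSup_of_iSupIndep ((iSupIndep_chains R).mono fun K =>
      inf_le_left.trans (boundaries_le_chains R))
  have h := betti_add_finrank R (ℓ := ℓ) (K := X)
  simp only [hZ, hB, ← betti_add_finrank, Finset.sum_add_distrib] at h
  exact Nat.add_right_cancel h

/-- A complex with at most `ℓ + 1` vertices has no `ℓ`-dimensional homology. -/
theorem betti_eq_zero_of_card_le [Nontrivial R] {σ : Finset V} (hσ : vertexSet K = (σ : Set V))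
    (hc : σ.card ≤ ℓ + 1) : betti R ℓ K = 0 := by
  have hZ : cycles R K ℓ = ⊥ := by
    rw [eq_bot_iff]
    rintro z ⟨hz, hz0⟩
    have hsupp : ∀ s, s ≠ σ → z s = 0 := by
      intro s hs
      refine (Finsupp.mem_supported' R z).1 hz s fun h => hs ?_
      have hsK : s ∈ K := h.1.resolve_right (Finset.card_pos.1 (by rw [h.2]; omega)).ne_empty
      exact Finset.eq_of_subset_of_card_le (le_restrict_of_vertexSet_eq le_rfl hσ hsK).2
        (by rw [h.2]; exact hc)
    have hzs : z = Finsupp.single σ (z σ) := by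
      ext s
      rw [Finsupp.single_apply]
      split_ifs with h
      · rw [h]
      · exact hsupp s (Ne.symm h)
    suffices z σ = 0 by rw [Submodule.mem_bot, hzs, this, Finsupp.single_zero]
    by_cases hcard : σ.card = ℓ + 1
    · obtain ⟨v, hv⟩ : σ.Nonempty := Finset.card_pos.1 (by omega)
      have h0 : boundary R z = 0 := hz0
      rw [hzs, boundary_single] at h0
      -- `σ` is the only possible `ℓ`-face, and the facet opposite `v` has coefficient `± z σ` in `∂
      -- z`.
      have h1 := DFunLike.congr_fun h0 (σ.erase v)
      rw [Finsupp.finsetSum_apply, Finset.sum_eq_single v] at h1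
      · rw [Finsupp.single_eq_same, Finsupp.zero_apply] at h1
        rcases neg_one_pow_eq_or R (σ.filter (· < v)).card with h | h <;> rw [h] at h1 <;>
          simpa using h1
      · intro w hw hwv
        refine Finsupp.single_eq_of_ne fun h => hwv ?_
        exact ((Finset.erase_inj σ hv).1 h).symm
      · exact fun h => absurd hv h
    · exact (Finsupp.mem_supported' R z).1 hz σ fun h => hcard h.2
  rw [betti, hZ]
  exact Module.finrank_zero_of_subsingleton

/-- The restriction is the only candidate counted by `eta`; `hX` ensures that its vertex set is all
of `σ`. -/
theorem eta_eq_inducedEta (hX : ∀ v, {v} ∈ X) (r : ℕ) (σ : Finset V)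
    (h : ℓ = 1 ∨ IsStronglyConnected ℓ (restrict X σ)) :
    eta R X r ℓ σ = inducedEta R X r ℓ σ := by
  have hv : vertexSet (restrict X σ) = (σ : Set V) := by
    ext v
    exact ⟨fun hv => Finset.singleton_subset_iff.1 hv.2,
      fun hv => ⟨hX v, Finset.singleton_subset_iff.2 hv⟩⟩
  rw [eta, inducedEta]
  split_ifs with hmax
  · rw [Set.ncard_eq_one]
    refine ⟨restrict X σ, Set.eq_singleton_iff_unique_mem.2 ⟨⟨hmax.1, hv, hmax.2⟩, ?_⟩⟩
    exact fun K hK => hK.1.eq_restrict hK.2.1 h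
  · convert! Set.ncard_empty (PreAbstractSimplicialComplex V) using 2
    refine Set.eq_empty_iff_forall_notMem.2 fun K hK => hmax ?_
    rw [← hK.1.eq_restrict hK.2.1 h]
    exact ⟨hK.1, hK.2.2⟩

/-- Counting the maximal `ℓ`-strongly connected subcomplexes by vertex set and Betti number. -/
theorem sum_betti_eq_sum_eta [Nontrivial R] [Fintype V] [Fintype {K // IsMaxStronglyConnected X ℓ K}] :
    ∑ K : {K // IsMaxStronglyConnected X ℓ K}, betti R ℓ K.1 =
      ∑ j ∈ Finset.Icc (ℓ + 2) (Fintype.card V), ∑ᶠ (r : ℕ) (_ : 1 ≤ r),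
        ∑ σ ∈ Finset.powersetCard j (Finset.univ : Finset V), r * eta R X r ℓ σ := by
  classical
  set b : {K // IsMaxStronglyConnected X ℓ K} → ℕ := fun K => betti R ℓ K.1
  let vs : {K // IsMaxStronglyConnected X ℓ K} → Finset V :=
    fun K => Finset.univ.filter fun v => v ∈ vertexSet K.1
  have hvs : ∀ K (σ : Finset V), vertexSet K.1 = (σ : Set V) ↔ vs K = σ := by
    intro K σ
    rw [← Finset.coe_inj]
    simp [vs]
  have heta : ∀ r σ, eta R X r ℓ σ = ∑ K, if vs K = σ ∧ b K = r then 1 else 0 := by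
    intro r σ
    rw [Finset.sum_boole, Nat.cast_id, eta,
      ← Set.ncard_coe_finset, ← Set.ncard_image_of_injective _ Subtype.val_injective]
    congr 1
    ext K
    constructor
    · rintro ⟨h1, h2, h3⟩
      exact ⟨⟨K, h1⟩, by simpa using ⟨(hvs ⟨K, h1⟩ σ).1 h2, h3⟩, rfl⟩
    · rintro ⟨K, hK, rfl⟩
      simp only [Finset.coe_filter, Finset.mem_univ, true_and, Set.mem_ofPred_eq] at hK
      exact ⟨K.2, (hvs K σ).2 hK.1, hK.2⟩
  -- `N` bounds every Betti number, which truncates the sum over `r` to a finite one and permits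
  -- exchanging sums.
  let N := ∑ K, b K
  have hN : ∀ K, b K ≤ N := fun K => Finset.single_le_sum (fun _ _ => Nat.zero_le _)
    (Finset.mem_univ K)
  have hfin : ∀ j, (∑ᶠ (r : ℕ) (_ : 1 ≤ r),
      ∑ σ ∈ Finset.powersetCard j (Finset.univ : Finset V), r * eta R X r ℓ σ) =
      ∑ r ∈ Finset.Icc 1 N, ∑ σ ∈ Finset.powersetCard j (Finset.univ : Finset V),
        r * eta R X r ℓ σ := by
    intro j
    refine finsum_mem_eq_sum_of_inter_support_eq (s := {r | 1 ≤ r}) _ ?_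
    ext r
    simp only [Set.mem_inter_iff, Set.mem_ofPred_eq, Finset.coe_Icc, Set.mem_Icc, and_assoc]
    refine and_congr_right fun _ => ⟨fun h => ⟨?_, h⟩, fun h => h.2⟩
    by_contra hr
    refine h (Finset.sum_eq_zero fun σ _ => ?_)
    rw [heta, Finset.sum_eq_zero, mul_zero]
    intro K _
    rw [if_neg]
    rintro ⟨-, rfl⟩
    exact hr (hN K)
  simp only [hfin]
  simp only [heta, Finset.mul_sum, mul_ite, mul_one, mul_zero]
  have hswap : ∀ j, (∑ r ∈ Finset.Icc 1 N, ∑ σ ∈ Finset.powersetCard j (Finset.univ : Finset V),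
      ∑ K, if vs K = σ ∧ b K = r then r else 0) =
      ∑ K, ∑ r ∈ Finset.Icc 1 N, ∑ σ ∈ Finset.powersetCard j (Finset.univ : Finset V),
        if vs K = σ ∧ b K = r then r else 0 := by
    intro j
    simp only [Finset.sum_comm (t := (Finset.univ : Finset {K // IsMaxStronglyConnected X ℓ K}))]
  simp only [hswap]
  rw [Finset.sum_comm]
  refine Finset.sum_congr rfl fun K _ => ?_
  rcases Nat.eq_zero_or_pos (b K) with h0 | hpos
  · rw [h0]
    symm
    refine Finset.sum_eq_zero fun j _ => Finset.sum_eq_zero fun r hr =>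
      Finset.sum_eq_zero fun σ _ => if_neg ?_
    rintro ⟨-, h⟩
    have := (Finset.mem_Icc.1 hr).1
    omega
  -- Nonzero `β_ℓ` needs at least `ℓ + 2` vertices, so `j` starting at `ℓ + 2` loses nothing. Only
  -- the term `j = |vs K|`, `r = b K`, `σ = vs K` survives.
  · have hcard : ℓ + 2 ≤ (vs K).card := by
      by_contra hlt
      exact hpos.ne' (betti_eq_zero_of_card_le R ((hvs K _).2 rfl) (by omega))
    rw [Finset.sum_eq_single_of_mem (vs K).card
        (Finset.mem_Icc.2 ⟨hcard, Finset.card_le_univ _⟩),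
      Finset.sum_eq_single_of_mem (b K) (Finset.mem_Icc.2 ⟨hpos, hN K⟩),
      Finset.sum_eq_single_of_mem (vs K)
        (Finset.mem_powersetCard.2 ⟨Finset.subset_univ _, rfl⟩), if_pos ⟨rfl, rfl⟩]
    · exact fun σ _ hσ => if_neg fun h => hσ h.1.symm
    · exact fun r _ hr => Finset.sum_eq_zero fun σ _ => if_neg fun h => hr h.2.symm
    · intro j _ hj
      refine Finset.sum_eq_zero fun r _ => Finset.sum_eq_zero fun σ hσ => if_neg fun h => hj ?_
      rw [h.1, (Finset.mem_powersetCard.1 hσ).2]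

end Betti

/-- The face condition is vacuous: a singleton has no subset with two elements. -/
theorem singleton_mem_dynComplex {Ω : Type*} {n : ℕ} (W : Simplex n → Input → Ω → ℝ) (t : ℝ)
    (ω : Ω) (v : Fin n) : {v} ∈ dynComplex W t ω := by
  refine ⟨Finset.singleton_nonempty v, fun B hB => ?_⟩
  have h1 := Finset.card_le_card hB
  have h2 := B.2
  rw [Finset.card_singleton] at h1
  omega

end DynComplex

/-! ### Application to the dynamic complex -/

theorem proposition7p6 {Ω : Type*} [MeasurableSpace Ω] (P : MeasureTheory.Measure Ω)
    [MeasureTheory.IsProbabilityMeasure P] (R : Type*) [CommRing R] [IsDomain R]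
    (n : ℕ) (p : ℕ → ℝ) (G : ℕ → MeasureTheory.Measure ℝ)
    (W : DynComplex.Simplex n → DynComplex.Input → Ω → ℝ)
    (hW : DynComplex.IsModel P n p G W)
    (ℓ : ℕ) (hℓ : 1 ≤ ℓ) (t : ℝ) (ht : 0 ≤ t) (ω : Ω) :
    -- the representation of the Betti number
    DynComplex.betti R ℓ (DynComplex.dynComplex W t ω) =
        ∑ j ∈ Finset.Icc (ℓ + 2) n, ∑ᶠ (r : ℕ) (_ : 1 ≤ r),
          ∑ σ ∈ Finset.powersetCard j (Finset.univ : Finset (Fin n)),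
            r * DynComplex.eta R (DynComplex.dynComplex W t ω) r ℓ σ ∧
    -- the Betti number as the sum over the maximal `ℓ`-strongly connected subcomplexes
    DynComplex.betti R ℓ (DynComplex.dynComplex W t ω) =
        ∑ᶠ (K : PreAbstractSimplicialComplex (Fin n))
          (_ : DynComplex.IsMaxStronglyConnected (DynComplex.dynComplex W t ω) ℓ K),
            DynComplex.betti R ℓ K ∧
    -- `η_σ` is the indicator attached to the restriction of the complex to `σ` whenever that
    -- restriction is `ℓ`-strongly connected, and for every `σ` if `ℓ = 1`
    ∀ (σ : Finset (Fin n)) (r : ℕ),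
      (ℓ = 1 ∨ DynComplex.IsStronglyConnected ℓ
        (DynComplex.restrict (DynComplex.dynComplex W t ω) σ)) →
      DynComplex.eta R (DynComplex.dynComplex W t ω) r ℓ σ =
        DynComplex.inducedEta R (DynComplex.dynComplex W t ω) r ℓ σ := by
  classical
  have : Fintype {K // DynComplex.IsMaxStronglyConnected (DynComplex.dynComplex W t ω) ℓ K} :=
    Fintype.ofFinite _
  have hsum := DynComplex.betti_eq_sum R (ℓ := ℓ) (X := DynComplex.dynComplex W t ω)
  refine ⟨?_, ?_, fun σ r h =>
    DynComplex.eta_eq_inducedEta R (DynComplex.singleton_mem_dynComplex W t ω) r σ h⟩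
  · rw [hsum, DynComplex.sum_betti_eq_sum_eta, Fintype.card_fin]
  · rw [hsum, ← finsum_eq_sum_of_fintype]
    exact finsum_subtype_eq_finsum_cond (f := DynComplex.betti R ℓ) _
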